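/- For a positive integer $k$ and a finite set $A\subset\mathbb{Z}^d$, let $E_k(A)$ denote the number of $2k$-tuples $(a_1,\ldots,a_{2k})\in A^{2k}$ such that $a_1+\cdots+a_k=a_{k+1}+\cdots+a_{2k}$, and let $|A|$ denote the cardinality of $A$. Set $p_k=\log_2\binom{2k}{k}$. Then, for all positive integers $d,k$ and every set $A\subseteq\{0,1\}^d\subset\mathbb{Z}^d$, $$E_k(A)\leq |A|^{p_k}.$$ Moreover, for all positive integers $d,k$ the exponent $p_k$ is the smallest possible: if $q$ is a real number such that $E_k(A)\leq|A|^{q}$ for every $A\subseteq\{0,1\}^d$, then $p_k\leq q$. -/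

import Mathlib

/-- The `k`-additive energy of a finite set `A ⊂ ℤ^d`: the number of `2k`-tuples
`(a_1, …, a_{2k}) ∈ A^{2k}` with `a_1 + ⋯ + a_k = a_{k+1} + ⋯ + a_{2k}`. -/
def additiveEnergyK {d : ℕ} (k : ℕ) (A : Finset (Fin d → ℤ)) : ℕ :=
  ((Fintype.piFinset fun _ : Fin (k + k) => A).filter fun a =>
    ∑ i : Fin k, a (Fin.castAdd k i) = ∑ i : Fin k, a (Fin.natAdd k i)).card

/-- The discrete hypercube `{0,1}^d ⊂ ℤ^d`. -/
def discreteHypercube (d : ℕ) : Finset (Fin d → ℤ) :=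
  Fintype.piFinset fun _ : Fin d => {0, 1}

/-- The exponent `p_k = log_2 (2k choose k)`. -/
noncomputable def energyExponent (k : ℕ) : ℝ :=
  Real.logb 2 ((Nat.choose (2 * k) k : ℕ) : ℝ)

open Finset

/-! For a modulus m > k, the energy of A is the average over (ℤ/m)^d of |F|^(2k), where F is the
Fourier transform of the indicator of A. The bound is thus the indicator case of a Hausdorff–Young
inequality on the cube (`sum_norm_cubeFourier_pow_le`), which tensorizes. Splitting off one
coordinate, Parseval produces the weights C(k,j)^2, Hölder bounds the mixed moments of the two
halves, and what remains is the two-point inequality `sum_sq_choose_le`.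

By symmetry and homogeneity that inequality reduces to ∑ C(k,j)^2 t^j ≤ (1 + t^c)^p on [0,1], with p
= p_k and c = k/p (`sqChoosePoly_le`). Equality holds at both endpoints, so convexity-free sign
counting is used: the derivative of the log-difference has the sign opposite to e = r - t^c, where r
is a ratio of weighted sums satisfying a Riccati equation. At a zero of e this equation makes the
sign of e' that of an explicit strictly increasing function, so e cannot cross upward and later
downward, as a negative log-difference would force.

The exponent is optimal already for a two-point set. -/

/-! ### Power sums. -/

/-- The power sum `∑_{j ≤ k} a_j t^j`. -/
noncomputable def powSum (k : ℕ) (a : ℕ → ℝ) (t : ℝ) : ℝ :=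
  ∑ j ∈ range (k + 1), a j * t ^ j

theorem powSum_hasDerivAt (k : ℕ) (a : ℕ → ℝ) {t : ℝ} (ht : t ≠ 0) :
    HasDerivAt (powSum k a) (powSum k (fun j => j * a j) t / t) t := by
  unfold powSum
  rw [Finset.sum_div]
  refine HasDerivAt.fun_sum fun j _ => ?_
  refine ((hasDerivAt_pow j t).const_mul (a j)).congr_deriv ?_
  rcases j with _ | j
  · simp
  · field_simp
    simp
    ring

theorem powSum_continuous (k : ℕ) (a : ℕ → ℝ) : Continuous (powSum k a) := by
  unfold powSum; fun_prop

theorem powSum_zero (k : ℕ) (a : ℕ → ℝ) : powSum k a 0 = a 0 := by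
  unfold powSum
  rw [Finset.sum_eq_single 0] <;> simp +contextual

theorem powSum_nonneg (k : ℕ) {a : ℕ → ℝ} (ha : ∀ j ≤ k, 0 ≤ a j) {t : ℝ} (ht : 0 ≤ t) :
    0 ≤ powSum k a t :=
  Finset.sum_nonneg fun j hj =>
    mul_nonneg (ha j (by simpa [Nat.lt_succ_iff] using hj)) (pow_nonneg ht j)

theorem le_powSum (k : ℕ) {a : ℕ → ℝ} (ha : ∀ j ≤ k, 0 ≤ a j) {t : ℝ} (ht : 0 ≤ t) :
    a 0 ≤ powSum k a t := by
  have h := Finset.single_le_sum (f := fun j => a j * t ^ j) (s := range (k + 1))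
    (fun j hj => mul_nonneg (ha j (by simpa [Nat.lt_succ_iff] using hj)) (pow_nonneg ht j))
    (Finset.mem_range.2 (Nat.succ_pos k))
  simpa [powSum] using h

theorem powSum_le_mul (k : ℕ) {a : ℕ → ℝ} (ha : ∀ j ≤ k, 0 ≤ a j) (h0 : a 0 = 0) {t : ℝ}
    (ht : 0 ≤ t) (ht1 : t ≤ 1) : powSum k a t ≤ t * powSum k a 1 := by
  unfold powSum
  rw [Finset.mul_sum]
  refine Finset.sum_le_sum fun j hj => ?_
  rcases j with _ | j
  · simp [h0]
  · have hj' := ha (j + 1) (by simpa [Nat.lt_succ_iff] using hj)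
    have : t ^ (j + 1) ≤ t := by
      rw [pow_succ]; exact mul_le_of_le_one_left ht (pow_le_one₀ ht ht1)
    simpa [mul_comm t] using mul_le_mul_of_nonneg_left this hj'

/-! ### Squared binomial sums and the Riccati equation. -/

/-- `∑_j C(k,j)^2 t^j`. -/
noncomputable def sqChoosePoly (k : ℕ) : ℝ → ℝ := powSum k fun j => (k.choose j : ℝ) ^ 2

/-- `∑_j j C(k,j)^2 t^j`. -/
noncomputable def sqChooseUp (k : ℕ) : ℝ → ℝ := powSum k fun j => j * (k.choose j : ℝ) ^ 2

/-- `∑_j (k-j) C(k,j)^2 t^j`. -/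
noncomputable def sqChooseDown (k : ℕ) : ℝ → ℝ :=
  powSum k fun j => (k - j) * (k.choose j : ℝ) ^ 2

theorem sqChooseUp_add_down (k : ℕ) (t : ℝ) :
    sqChooseUp k t + sqChooseDown k t = k * sqChoosePoly k t := by
  unfold sqChooseUp sqChooseDown sqChoosePoly powSum
  rw [← Finset.sum_add_distrib, Finset.mul_sum]
  exact Finset.sum_congr rfl fun j _ => by ring

/-- Square (j+1) C(k,j+1) = (k-j) C(k,j) and shift the index. This is the relation that closes the
differential system for the two weighted sums. -/
theorem powSum_sq_mul_sq_choose (k : ℕ) (t : ℝ) :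
    powSum k (fun j => j * (j * (k.choose j : ℝ) ^ 2)) t =
      t * powSum k (fun j => (k - j) * ((k - j) * (k.choose j : ℝ) ^ 2)) t := by
  unfold powSum
  rw [Finset.sum_range_succ', Finset.sum_range_succ, mul_add, Finset.mul_sum]
  simp only [sub_self, zero_mul, mul_zero, Nat.cast_zero, add_zero]
  refine Finset.sum_congr rfl fun j hj => ?_
  have h : ((k.choose (j + 1) : ℝ)) * (j + 1) = k.choose j * (k - j) := by
    have h1 := Nat.choose_succ_right_eq k j
    have hj' : j ≤ k := (Finset.mem_range.1 hj).le
    have h2 : ((k.choose (j + 1) * (j + 1) : ℕ) : ℝ) = ((k.choose j * (k - j) : ℕ) : ℝ) := by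
      rw [h1]
    push_cast [Nat.cast_sub hj'] at h2
    exact h2
  push_cast
  linear_combination (k.choose (j + 1) * ((j : ℝ) + 1) + k.choose j * (k - j)) * t ^ (j + 1) * h

/-- The Riccati equation satisfied by the ratio of the two weighted sums. -/
theorem sqChoose_ratio_riccati (k : ℕ) {t : ℝ} (ht : 0 < t) (ht1 : t < 1)
    (hQ : 0 < sqChooseDown k t) :
    HasDerivAt (fun s => sqChooseUp k s / sqChooseDown k s)
      (k * (t - (sqChooseUp k t / sqChooseDown k t) ^ 2) / (t * (1 - t))) t := by
  have hP' := powSum_hasDerivAt k (fun j => j * (k.choose j : ℝ) ^ 2) ht.ne'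
  have hQ' := powSum_hasDerivAt k (fun j => (k - j) * (k.choose j : ℝ) ^ 2) ht.ne'
  refine (hP'.div hQ' hQ.ne').congr_deriv ?_
  rw [powSum_sq_mul_sq_choose]
  set W := powSum k (fun j => (k - j) * ((k - j) * (k.choose j : ℝ) ^ 2)) t with hW
  -- The mixed sum with weight j(k-j) is computed in two ways; equating them in `e3` eliminates `W`.
  have e1 : powSum k (fun j => j * ((k - j) * (k.choose j : ℝ) ^ 2)) t =
      k * sqChooseUp k t - t * W := by
    rw [hW, ← powSum_sq_mul_sq_choose]
    unfold sqChooseUp powSum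
    rw [Finset.mul_sum, ← Finset.sum_sub_distrib]
    exact Finset.sum_congr rfl fun j _ => by ring
  have e2 : powSum k (fun j => j * ((k - j) * (k.choose j : ℝ) ^ 2)) t =
      k * sqChooseDown k t - W := by
    rw [hW]
    unfold sqChooseDown powSum
    rw [Finset.mul_sum, ← Finset.sum_sub_distrib]
    exact Finset.sum_congr rfl fun j _ => by ring
  have e3 : W * (1 - t) = k * (sqChooseDown k t - sqChooseUp k t) := by linarith
  rw [e1]
  change (t * W / t * sqChooseDown k t - sqChooseUp k t * ((k * sqChooseUp k t - t * W) / t)) /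
    sqChooseDown k t ^ 2 = _
  have h1 : (1 - t) ≠ 0 := by linarith
  have h2 := ht.ne'
  have h3 := hQ.ne'
  field_simp
  linear_combination t * (sqChooseUp k t + sqChooseDown k t) * e3

/-! ### Crossings and monotonicity in one variable. -/

/-- An upward crossing: the function vanishes there with nonnegative derivative. -/
theorem exists_zero_deriv_nonneg {f f' : ℝ → ℝ} {a b : ℝ} (hab : a < b)
    (hf : ∀ x ∈ Set.Icc a b, HasDerivAt f (f' x) x) (ha : f a < 0) (hb : 0 < f b) :
    ∃ z ∈ Set.Ioo a b, f z = 0 ∧ 0 ≤ f' z := by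
  have hc : ContinuousOn f (Set.Icc a b) := fun x hx => (hf x hx).continuousAt.continuousWithinAt
  -- The crossing is the last point where f ≤ 0: slopes to its right are positive.
  set S := Set.Icc a b ∩ f ⁻¹' Set.Iic 0 with hS
  have hScl : IsClosed S := hc.preimage_isClosed_of_isClosed isClosed_Icc isClosed_Iic
  have hSc : IsCompact S := isCompact_Icc.of_isClosed_subset hScl Set.inter_subset_left
  have hne : S.Nonempty := ⟨a, ⟨le_rfl, hab.le⟩, ha.le⟩
  obtain ⟨z, ⟨hz, hz0⟩, hmax⟩ := hSc.exists_isGreatest hne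
  have hz0 : f z ≤ 0 := hz0
  have hzb : z < b := lt_of_le_of_ne hz.2 (by rintro rfl; linarith)
  have hpos : ∀ x ∈ Set.Ioc z b, 0 < f x := fun x hx => by
    by_contra! h
    exact absurd (hmax ⟨⟨hz.1.trans hx.1.le, hx.2⟩, h⟩) (not_le.2 hx.1)
  have hfz : f z = 0 := by
    refine le_antisymm hz0 ?_
    have ht : Filter.Tendsto f (nhdsWithin z (Set.Ioi z)) (nhds (f z)) :=
      (hf z hz).continuousAt.tendsto.mono_left nhdsWithin_le_nhds
    refine ge_of_tendsto ht ?_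
    filter_upwards [Ioc_mem_nhdsGT hzb] with x hx using (hpos x hx).le
  have hza : a < z := lt_of_le_of_ne hz.1 (by rintro rfl; linarith)
  refine ⟨z, ⟨hza, hzb⟩, hfz, ?_⟩
  have ht := (hasDerivAt_iff_tendsto_slope.1 (hf z hz)).mono_left
    (nhdsWithin_mono z (fun x (hx : x ∈ Set.Ioi z) => (Set.mem_Ioi.1 hx).ne'))
  refine ge_of_tendsto ht ?_
  filter_upwards [Ioc_mem_nhdsGT hzb] with x hx
  rw [slope_def_field, hfz, sub_zero]
  exact div_nonneg (hpos x hx).le (sub_pos.2 hx.1).le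

/-- The difference of the two sides vanishes at 0 and has derivative (1 - l²) sinh(lx) sinh x > 0.
-/
theorem sinh_mul_cosh_lt {l x : ℝ} (hl : 0 < l) (hl1 : l < 1) (hx : 0 < x) :
    l * Real.cosh (l * x) * Real.sinh x < Real.sinh (l * x) * Real.cosh x := by
  have hd : ∀ y : ℝ, HasDerivAt
      (fun y => Real.sinh (l * y) * Real.cosh y - l * Real.cosh (l * y) * Real.sinh y)
      ((1 - l ^ 2) * (Real.sinh (l * y) * Real.sinh y)) y := fun y => by
    have h1 := ((hasDerivAt_id y).const_mul l).sinh
    have h2 := ((hasDerivAt_id y).const_mul l).cosh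
    refine ((h1.mul (Real.hasDerivAt_cosh y)).sub
      ((h2.const_mul l).mul (Real.hasDerivAt_sinh y))).congr_deriv ?_
    simp only [id]
    ring
  have hm := strictMonoOn_of_deriv_pos (convex_Ici (0 : ℝ))
    (fun y _ => (hd y).continuousAt.continuousWithinAt) (fun y hy => by
      rw [interior_Ici] at hy
      have hy : 0 < y := hy
      rw [(hd y).deriv]
      have := Real.sinh_pos_iff.2 (mul_pos hl hy)
      have := Real.sinh_pos_iff.2 hy
      have : 0 < 1 - l ^ 2 := by nlinarith
      positivity)
  have := hm (Set.mem_Ici.2 le_rfl) (Set.mem_Ici.2 hx.le) hx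
  simp at this
  linarith

theorem sinh_mul_div_sinh_strictAntiOn {l : ℝ} (hl : 0 < l) (hl1 : l < 1) :
    StrictAntiOn (fun x => Real.sinh (l * x) / Real.sinh x) (Set.Ioi 0) := by
  have hd : ∀ y : ℝ, 0 < y → HasDerivAt (fun x => Real.sinh (l * x) / Real.sinh x)
      ((l * Real.cosh (l * y) * Real.sinh y - Real.sinh (l * y) * Real.cosh y) /
        Real.sinh y ^ 2) y := fun y hy => by
    have h1 := ((hasDerivAt_id y).const_mul l).sinh
    refine (h1.div (Real.hasDerivAt_sinh y) (Real.sinh_pos_iff.2 hy).ne').congr_deriv ?_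
    simp only [id]
    ring
  refine strictAntiOn_of_deriv_neg (convex_Ioi 0)
    (fun y hy => (hd y hy).continuousAt.continuousWithinAt) fun y hy => ?_
  rw [interior_Ioi] at hy
  have hy : 0 < y := hy
  rw [(hd y hy).deriv]
  exact div_neg_of_neg_of_pos (by linarith [sinh_mul_cosh_lt hl hl1 hy])
    (pow_pos (Real.sinh_pos_iff.2 hy) 2)

/-- With t = exp(-2x) the quotient is sinh((2c-1)x) / sinh x, which decreases in x. -/
theorem rpow_sub_rpow_div_strictMonoOn {c : ℝ} (hc : 1 / 2 < c) (hc1 : c < 1) :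
    StrictMonoOn (fun t : ℝ => (t ^ (1 - c) - t ^ c) / (1 - t)) (Set.Ioo 0 1) := by
  have key : ∀ t ∈ Set.Ioo (0 : ℝ) 1, (t ^ (1 - c) - t ^ c) / (1 - t) =
      Real.sinh ((2 * c - 1) * (-Real.log t / 2)) / Real.sinh (-Real.log t / 2) := by
    intro t ht
    have hv : 0 < -Real.log t / 2 := by linarith [Real.log_neg ht.1 ht.2]
    have hs := Real.sinh_pos_iff.2 hv
    have ht1 : 1 - t ≠ 0 := by linarith [ht.2]
    rw [div_eq_div_iff ht1 hs.ne', Real.rpow_def_of_pos ht.1, Real.rpow_def_of_pos ht.1]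
    obtain ⟨v, hv⟩ : ∃ v, v = Real.log t := ⟨_, rfl⟩
    have htv : t = Real.exp v := by rw [hv, Real.exp_log ht.1]
    rw [← hv, htv, Real.sinh_eq, Real.sinh_eq]
    simp only [sub_mul, mul_sub, div_mul_eq_mul_div, mul_div_assoc', mul_one, one_mul,
      ← Real.exp_add]
    ring_nf
  intro x hx y hy hxy
  simp only
  rw [key x hx, key y hy]
  refine sinh_mul_div_sinh_strictAntiOn (by linarith) (by linarith) ?_ ?_ ?_
  · simp only [Set.mem_Ioi]; linarith [Real.log_neg hy.1 hy.2]
  · simp only [Set.mem_Ioi]; linarith [Real.log_neg hx.1 hx.2]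
  · linarith [Real.log_lt_log hx.1 hxy]

/-! ### The exponent and the sharp one-variable inequality. -/

theorem sqChoosePoly_one (k : ℕ) : sqChoosePoly k 1 = (2 * k).choose k := by
  simp only [sqChoosePoly, powSum, one_pow, mul_one]
  exact_mod_cast Nat.sum_range_choose_sq k

theorem two_rpow_energyExponent (k : ℕ) : (2 : ℝ) ^ energyExponent k = (2 * k).choose k := by
  unfold energyExponent
  rw [Real.rpow_logb (by norm_num) (by norm_num)]
  exact_mod_cast Nat.choose_pos (by omega)

/-- Gives c = k/p < 1; `energyExponent_lt` gives c > 1/2. Both are needed for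
`rpow_sub_rpow_div_strictMonoOn`. -/
theorem lt_energyExponent {k : ℕ} (hk : 2 ≤ k) : (k : ℝ) < energyExponent k := by
  unfold energyExponent
  rw [Real.lt_logb_iff_rpow_lt (by norm_num) (by exact_mod_cast Nat.choose_pos (by omega)),
    Real.rpow_natCast]
  suffices h : 2 ^ k < (2 * k).choose k by exact_mod_cast h
  induction k, hk using Nat.le_induction with
  | base => decide
  | succ n hn ih =>
    have h := Nat.succ_mul_centralBinom_succ n
    simp only [Nat.centralBinom] at h
    rw [pow_succ]
    by_contra! h2
    have : (n + 1) * (2 * (n + 1)).choose (n + 1) ≤ (n + 1) * (2 ^ n * 2) :=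
      Nat.mul_le_mul_left _ h2
    rw [h] at this
    nlinarith

theorem energyExponent_lt {k : ℕ} (hk : 0 < k) : energyExponent k < 2 * k := by
  unfold energyExponent
  rw [Real.logb_lt_iff_lt_rpow (by norm_num) (by exact_mod_cast Nat.choose_pos (by omega))]
  have h : (2 * k).choose k < 2 ^ (2 * k) := by
    rw [← Nat.sum_range_choose (2 * k)]
    refine Finset.single_lt_sum (i := k) (j := 0) (by omega) (by simp; omega) (by simp) (by simp)
      (by simp)
  exact_mod_cast h

theorem sqChooseUp_nonneg (k : ℕ) {t : ℝ} (ht : 0 ≤ t) : 0 ≤ sqChooseUp k t :=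
  powSum_nonneg k (fun j _ => by positivity) ht

theorem le_sqChooseDown (k : ℕ) {t : ℝ} (ht : 0 ≤ t) : (k : ℝ) ≤ sqChooseDown k t := by
  have := le_powSum k (a := fun j => (k - j) * (k.choose j : ℝ) ^ 2)
    (fun j hj => mul_nonneg (sub_nonneg.2 (by exact_mod_cast hj)) (sq_nonneg _)) ht
  simpa [sqChooseDown] using this

theorem one_le_sqChoosePoly (k : ℕ) {t : ℝ} (ht : 0 ≤ t) : 1 ≤ sqChoosePoly k t := by
  have := le_powSum k (a := fun j => (k.choose j : ℝ) ^ 2) (fun j _ => by positivity) ht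
  simpa [sqChoosePoly] using this

/-- Near zero the ratio of the weighted sums is below any power `t^c` with `c < 1`. -/
theorem exists_ratio_lt_rpow {k : ℕ} (hk : 0 < k) {c b : ℝ} (hc1 : c < 1) (hb : 0 < b) :
    ∃ z ∈ Set.Ioo 0 b, sqChooseUp k z / sqChooseDown k z < z ^ c := by
  have hk' : (0 : ℝ) < k := by exact_mod_cast hk
  have h1 : Filter.Tendsto (fun t : ℝ => t ^ (1 - c) * (sqChooseUp k 1 / k))
      (nhdsWithin 0 (Set.Ioi 0)) (nhds 0) := by
    have h := (Real.continuousAt_rpow_const 0 (1 - c) (Or.inr (by linarith))).tendsto.mono_left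
      (nhdsWithin_le_nhds (s := Set.Ioi (0 : ℝ)))
    rw [Real.zero_rpow (by linarith)] at h
    simpa using h.mul_const (sqChooseUp k 1 / k)
  obtain ⟨z, hz, hz1⟩ := ((h1.eventually (gt_mem_nhds one_pos)).and
    (Ioo_mem_nhdsGT (lt_min hb one_pos))).exists
  have hz0 : 0 < z := hz1.1
  refine ⟨z, ⟨hz0, hz1.2.trans_le (min_le_left _ _)⟩, ?_⟩
  have hP : sqChooseUp k z ≤ z * sqChooseUp k 1 :=
    powSum_le_mul k (fun j _ => by positivity) (by simp) hz0.le
      (hz1.2.trans_le (min_le_right _ _)).le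
  have hP0 : 0 ≤ sqChooseUp k 1 := sqChooseUp_nonneg k zero_le_one
  calc sqChooseUp k z / sqChooseDown k z ≤ z * sqChooseUp k 1 / k :=
        div_le_div₀ (by positivity) hP hk' (le_sqChooseDown k hz0.le)
    _ = z ^ c * (z ^ (1 - c) * (sqChooseUp k 1 / k)) := by
        rw [← mul_assoc, ← Real.rpow_add hz0]; simp; ring
    _ < z ^ c := mul_lt_of_lt_one_right (Real.rpow_pos_of_pos hz0 c) hz

/-- The sharp bound for the polynomial `∑_j C(k,j)^2 t^j` on the unit interval. -/
theorem sqChoosePoly_le {k : ℕ} (hk : 2 ≤ k) {t : ℝ} (ht : 0 ≤ t) (ht1 : t ≤ 1) :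
    sqChoosePoly k t ≤ (1 + t ^ (k / energyExponent k)) ^ energyExponent k := by
  have hk0 : (0 : ℝ) < k := by exact_mod_cast (by omega : 0 < k)
  have hp1 := lt_energyExponent hk
  have hp2 := energyExponent_lt (k := k) (by omega)
  have h2p := two_rpow_energyExponent k
  set p := energyExponent k with hp
  have hp0 : 0 < p := hk0.trans hp1
  set c := k / p with hc
  have hc1 : c < 1 := (div_lt_one hp0).2 hp1
  have hc2 : 1 / 2 < c := by rw [hc, div_lt_div_iff₀ (by norm_num) hp0]; linarith
  have hc0 : 0 < c := by linarith
  have hpc : p * c = k := by rw [hc]; field_simp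
  set D : ℝ → ℝ := fun t => p * Real.log (1 + t ^ c) - Real.log (sqChoosePoly k t) with hD
  have hpos : ∀ s : ℝ, 0 ≤ s → 0 < 1 + s ^ c := fun s hs => by
    have := Real.rpow_nonneg hs c; linarith
  have hFpos : ∀ s : ℝ, 0 ≤ s → 0 < sqChoosePoly k s := fun s hs =>
    one_pos.trans_le (one_le_sqChoosePoly k hs)
  have hQpos : ∀ s : ℝ, 0 ≤ s → 0 < sqChooseDown k s := fun s hs =>
    hk0.trans_le (le_sqChooseDown k hs)
  have hDc : ContinuousOn D (Set.Icc 0 1) := by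
    refine ContinuousOn.sub (continuousOn_const.mul (ContinuousOn.log ?_ ?_))
      (ContinuousOn.log (powSum_continuous k _).continuousOn ?_)
    · exact continuousOn_const.add (continuousOn_id.rpow_const fun x _ => Or.inr hc0.le)
    · exact fun s hs => (hpos s hs.1).ne'
    · exact fun s hs => (hFpos s hs.1).ne'
  have hD0 : D 0 = 0 := by
    simp [hD, Real.zero_rpow hc0.ne', sqChoosePoly, powSum_zero]
  have hD1 : D 1 = 0 := by
    simp only [hD, Real.one_rpow]
    rw [sqChoosePoly_one, ← h2p, Real.log_rpow (by norm_num)]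
    norm_num
  -- Up to a negative factor, e is the derivative of D.
  set e : ℝ → ℝ := fun s => sqChooseUp k s / sqChooseDown k s - s ^ c with he
  have hD' : ∀ s ∈ Set.Ioo (0 : ℝ) 1, ∃ m : ℝ, 0 < m ∧ HasDerivAt D (-m * e s) s := by
    intro s hs
    have hs0 := hs.1.ne'
    have hF := powSum_hasDerivAt k (fun j => (k.choose j : ℝ) ^ 2) hs0
    have hFs := hFpos s hs.1.le
    have hQs := hQpos s hs.1.le
    have hPs := sqChooseUp_nonneg k hs.1.le
    have hx := hpos s hs.1.le
    refine ⟨k * sqChooseDown k s / (s * (1 + s ^ c) * (k * sqChoosePoly k s)), by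
      have := hs.1; positivity, ?_⟩
    refine (((((Real.hasDerivAt_rpow_const (p := c) (Or.inl hs0)).const_add 1).log hx.ne').const_mul
      p).sub (hF.log hFs.ne')).congr_deriv ?_
    change p * (c * s ^ (c - 1) / (1 + s ^ c)) - sqChooseUp k s / s / sqChoosePoly k s =
      -(k * sqChooseDown k s / (s * (1 + s ^ c) * (k * sqChoosePoly k s))) *
      (sqChooseUp k s / sqChooseDown k s - s ^ c)
    rw [← mul_div_assoc, ← mul_assoc, hpc, Real.rpow_sub_one hs0]
    have hsum := sqChooseUp_add_down k s
    have hFs' := hFs.ne'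
    have hQs' := hQs.ne'
    have hx' := hx.ne'
    field_simp
    linear_combination -(s ^ c) * hsum
  have hsign : ∀ a b : ℝ, 0 ≤ a → a < b → b ≤ 1 → ∃ z ∈ Set.Ioo a b, ∃ m : ℝ, 0 < m ∧
      -m * e z * (b - a) = D b - D a := by
    intro a b ha hab hb
    obtain ⟨z, hz, hz'⟩ := exists_deriv_eq_slope D hab
      (hDc.mono (Set.Icc_subset_Icc ha hb)) fun x hx =>
        (hD' x ⟨ha.trans_lt hx.1, hx.2.trans_le hb⟩).choose_spec.2.differentiableAt.differentiableWithinAt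
    obtain ⟨m, hm, hmd⟩ := hD' z ⟨ha.trans_lt hz.1, hz.2.trans_le hb⟩
    refine ⟨z, hz, m, hm, ?_⟩
    rw [← hmd.deriv, hz', div_mul_cancel₀ _ (by linarith)]
  set e' : ℝ → ℝ := fun s => k * (s - (sqChooseUp k s / sqChooseDown k s) ^ 2) / (s * (1 - s)) -
    c * s ^ (c - 1) with he'
  have hed : ∀ s ∈ Set.Ioo (0 : ℝ) 1, HasDerivAt e (e' s) s := fun s hs =>
    (sqChoose_ratio_riccati k hs.1 hs.2 (hQpos s hs.1.le)).sub
      (Real.hasDerivAt_rpow_const (Or.inl hs.1.ne'))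
  set ψ : ℝ → ℝ := fun s => k * ((s ^ (1 - c) - s ^ c) / (1 - s)) - c with hψ
  -- At a zero of e the ratio in the Riccati equation may be replaced by s^c, leaving an explicit
  -- function.
  have heψ : ∀ s ∈ Set.Ioo (0 : ℝ) 1, e s = 0 → e' s = s ^ (c - 1) * ψ s := by
    intro s hs hes
    have hes : sqChooseUp k s / sqChooseDown k s = s ^ c := by
      simp only [he] at hes; linarith
    simp only [he', hψ]
    have h1 : s ^ (1 - c) = s / s ^ c := by rw [Real.rpow_sub hs.1, Real.rpow_one]
    have hs0 := hs.1.ne'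
    have hsc := (Real.rpow_pos_of_pos hs.1 c).ne'
    have hs1 : 1 - s ≠ 0 := by linarith [hs.2]
    rw [hes, h1, Real.rpow_sub_one hs0]
    field_simp
  have hDnn : 0 ≤ D t := by
    -- If D(t) < 0, the mean value theorem gives e > 0 somewhere left of t and e < 0 somewhere right
    -- of it. Since e < 0 near 0, there are an upward crossing u and a later downward crossing v, so
    -- ψ(u) ≥ 0 ≥ ψ(v) with u < v.
    by_contra! hneg
    have ht0 : 0 < t := lt_of_le_of_ne ht (by rintro rfl; linarith)
    have htl : t < 1 := lt_of_le_of_ne ht1 (by rintro rfl; linarith)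
    obtain ⟨b, hb, m, hm, hmb⟩ := hsign 0 t le_rfl ht0 ht1
    obtain ⟨a, ha, n, hn, hna⟩ := hsign t 1 ht htl le_rfl
    have heb : 0 < e b := by
      by_contra! h
      have : 0 ≤ -m * e b * (t - 0) := by
        rw [neg_mul, ← mul_neg]; have := neg_nonneg.2 h; simp only [sub_zero]; positivity
      linarith
    have hea : e a < 0 := by
      by_contra! h
      have : 0 ≤ n * e a * (1 - t) := mul_nonneg (mul_nonneg hn.le h) (by linarith)
      linarith
    obtain ⟨z, hz, hez⟩ := exists_ratio_lt_rpow (k := k) (by omega) hc1 hb.1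
    have hez : e z < 0 := sub_neg.2 hez
    obtain ⟨u, hu, hu0, hu'⟩ := exists_zero_deriv_nonneg (f := e) (f' := e') hz.2
      (fun x hx => hed x ⟨hz.1.trans_le hx.1, by linarith [hx.2, hb.2]⟩) hez heb
    obtain ⟨v, hv, hv0, hv'⟩ := exists_zero_deriv_nonneg (f := fun x => -e x) (f' := fun x => -e' x)
      (hb.2.trans ha.1) (fun x hx => (hed x ⟨hb.1.trans_le hx.1, by linarith [hx.2, ha.2]⟩).neg)
      (by linarith) (by linarith)
    have hu1 : u ∈ Set.Ioo (0 : ℝ) 1 := ⟨hz.1.trans hu.1, by linarith [hu.2, hb.2]⟩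
    have hv1 : v ∈ Set.Ioo (0 : ℝ) 1 := ⟨hb.1.trans hv.1, by linarith [hv.2, ha.2]⟩
    rw [heψ u hu1 hu0] at hu'
    simp only [heψ v hv1 (by linarith)] at hv'
    have hψu : 0 ≤ ψ u := nonneg_of_mul_nonneg_right hu' (Real.rpow_pos_of_pos hu1.1 _)
    have hψv : ψ v ≤ 0 := by
      have : 0 ≤ -ψ v := nonneg_of_mul_nonneg_right (by linarith : 0 ≤ v ^ (c - 1) * -ψ v)
        (Real.rpow_pos_of_pos hv1.1 _)
      linarith
    have hlt := rpow_sub_rpow_div_strictMonoOn hc2 hc1 hu1 hv1 (hu.2.trans hv.1)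
    have := mul_lt_mul_of_pos_left hlt hk0
    simp only [hψ] at hψu hψv
    simp only at this
    linarith
  have : Real.log (sqChoosePoly k t) ≤ Real.log ((1 + t ^ c) ^ p) := by
    rw [Real.log_rpow (hpos t ht)]
    simp only [hD] at hDnn
    linarith
  exact (Real.log_le_log_iff (hFpos t ht) (Real.rpow_pos_of_pos (hpos t ht) _)).1 this

theorem energyExponent_one : energyExponent 1 = 1 := by
  simp [energyExponent]

theorem energyExponent_pos {k : ℕ} (hk : 0 < k) : 0 < energyExponent k := by
  rcases Nat.lt_or_ge 1 k with h | h
  · exact (by exact_mod_cast hk : (0 : ℝ) < k).trans (lt_energyExponent h)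
  · obtain rfl : k = 1 := by omega
    simp [energyExponent_one]

/-! ### The two-point inequality and Hölder. -/

theorem sum_sq_choose_le_of_le {k : ℕ} (hk : 0 < k) {x y : ℝ} (hy : 0 ≤ y) (hyx : y ≤ x) :
    ∑ j ∈ range (k + 1), (k.choose j : ℝ) ^ 2 *
        ((x ^ (energyExponent k / k)) ^ (k - j) * (y ^ (energyExponent k / k)) ^ j) ≤
      (x + y) ^ energyExponent k := by
  have hp0 := energyExponent_pos hk
  have hk0 : (0 : ℝ) < k := by exact_mod_cast hk
  -- For k = 1 the exponent is 1 and both sides equal x + y; the one-variable bound covers only k ≥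
  -- 2.
  rcases Nat.lt_or_ge 1 k with h | h
  swap
  · obtain rfl : k = 1 := by omega
    simp [energyExponent_one, Finset.sum_range_succ]
  set p := energyExponent k with hp
  rcases (hy.trans hyx).eq_or_lt with hx | hx
  · subst hx
    obtain rfl : y = 0 := le_antisymm hyx hy
    refine (Finset.sum_eq_zero fun j hj => ?_).trans_le (Real.rpow_nonneg (by simp) _)
    rw [Real.zero_rpow (by positivity), ← pow_add, zero_pow, mul_zero]
    have := Finset.mem_range.1 hj
    omega
  -- Chosen so that t^(k/p) = y/x; factoring out x^p leaves the one-variable inequality.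
  set t := (y / x) ^ (p / k) with ht
  have hyx0 : 0 ≤ y / x := by positivity
  have ht0 : 0 ≤ t := Real.rpow_nonneg hyx0 _
  have ht1 : t ≤ 1 := Real.rpow_le_one hyx0 ((div_le_one hx).2 hyx) (by positivity)
  have hyt : y ^ (p / k) = x ^ (p / k) * t := by
    rw [ht, ← Real.mul_rpow hx.le hyx0, mul_div_cancel₀ _ hx.ne']
  have htc : t ^ (k / p) = y / x := by
    rw [ht, ← Real.rpow_mul hyx0]
    have : p / k * (k / p) = 1 := by field_simp
    rw [this, Real.rpow_one]
  have hxk : (x ^ (p / k)) ^ k = x ^ p := by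
    rw [← Real.rpow_natCast, ← Real.rpow_mul hx.le, div_mul_cancel₀ _ hk0.ne']
  have key := sqChoosePoly_le h ht0 ht1
  rw [← hp, htc] at key
  calc _ = x ^ p * sqChoosePoly k t := by
        unfold sqChoosePoly powSum
        rw [Finset.mul_sum]
        refine Finset.sum_congr rfl fun j hj => ?_
        have hj' : j ≤ k := Nat.lt_succ_iff.1 (Finset.mem_range.1 hj)
        rw [hyt, mul_pow, ← mul_assoc (_ ^ (k - j)), ← pow_add, Nat.sub_add_cancel hj', hxk]
        ring
    _ ≤ x ^ p * (1 + y / x) ^ p := by gcongr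
    _ = (x + y) ^ p := by
        rw [← Real.mul_rpow hx.le (by positivity)]
        congr 1
        field_simp

theorem sum_sq_choose_le {k : ℕ} (hk : 0 < k) {x y : ℝ} (hx : 0 ≤ x) (hy : 0 ≤ y) :
    ∑ j ∈ range (k + 1), (k.choose j : ℝ) ^ 2 *
        ((x ^ (energyExponent k / k)) ^ (k - j) * (y ^ (energyExponent k / k)) ^ j) ≤
      (x + y) ^ energyExponent k := by
  rcases le_total y x with h | h
  · exact sum_sq_choose_le_of_le hk hy h
  · rw [← Finset.sum_range_reflect, add_comm x y]
    refine (Finset.sum_congr rfl fun j hj => ?_).trans_le (sum_sq_choose_le_of_le hk hx h)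
    have hj' : j ≤ k := Nat.lt_succ_iff.1 (Finset.mem_range.1 hj)
    have e1 : k + 1 - 1 - j = k - j := by omega
    rw [e1, Nat.choose_symm hj', Nat.sub_sub_self hj', mul_comm ((x ^ _) ^ _)]

/-- Hölder's inequality for integer exponents, in homogeneous form. -/
theorem sum_pow_mul_pow_le {ι : Type*} (s : Finset ι) {k : ℕ} (hk : 0 < k) {j : ℕ} (hj : j ≤ k)
    {u v : ι → ℝ} (hu : ∀ x, 0 ≤ u x) (hv : ∀ x, 0 ≤ v x) {C a b : ℝ} (hC : 0 ≤ C)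
    (ha : 0 ≤ a) (hb : 0 ≤ b) (hua : ∑ x ∈ s, u x ^ k ≤ C * a ^ k)
    (hvb : ∑ x ∈ s, v x ^ k ≤ C * b ^ k) :
    ∑ x ∈ s, u x ^ (k - j) * v x ^ j ≤ C * (a ^ (k - j) * b ^ j) := by
  have vanish : ∀ w : ι → ℝ, (∀ x, 0 ≤ w x) → ∑ x ∈ s, w x ^ k ≤ C * 0 ^ k →
      ∀ x ∈ s, w x = 0 := by
    intro w hw h x hx
    rw [zero_pow hk.ne', mul_zero] at h
    have h0 := (Finset.sum_eq_zero_iff_of_nonneg fun x _ => pow_nonneg (hw x) k).1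
      (le_antisymm h (Finset.sum_nonneg fun x _ => pow_nonneg (hw x) k)) x hx
    exact eq_zero_of_pow_eq_zero h0
  rcases Nat.eq_zero_or_pos j with rfl | hj0
  · simpa using hua
  rcases hj.eq_or_lt with rfl | hjk
  · simpa using hvb
  rcases ha.eq_or_lt with rfl | ha
  · refine (Finset.sum_eq_zero fun x hx => ?_).trans_le (by positivity)
    rw [vanish u hu hua x hx, zero_pow (by omega), zero_mul]
  rcases hb.eq_or_lt with rfl | hb
  · refine (Finset.sum_eq_zero fun x hx => ?_).trans_le (by positivity)
    rw [vanish v hv hvb x hx, zero_pow (n := j) (by omega), mul_zero]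
  have hk0 : (0 : ℝ) < k := by exact_mod_cast hk
  have hjr : ((k - j : ℕ) : ℝ) = k - j := Nat.cast_sub hj
  have hjk' : (j : ℝ) ≤ k := by exact_mod_cast hj
  -- Weighted AM-GM applied to (u/a)^k and (v/b)^k, with weights (k-j)/k and j/k.
  have key : ∀ x, u x ^ (k - j) * v x ^ j ≤ (a ^ (k - j) * b ^ j) *
      ((k - j) / k * (u x ^ k / a ^ k) + j / k * (v x ^ k / b ^ k)) := by
    intro x
    have hr : ∀ y : ℝ, 0 ≤ y → ∀ i : ℕ, (y ^ k) ^ ((i : ℝ) / k) = y ^ i := by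
      intro y hy i
      rw [← Real.rpow_natCast y k, ← Real.rpow_mul hy, mul_div_cancel₀ _ hk0.ne',
        Real.rpow_natCast]
    have h1 : 0 ≤ u x / a := div_nonneg (hu x) ha.le
    have h2 : 0 ≤ v x / b := div_nonneg (hv x) hb.le
    have h := Real.geom_mean_le_arith_mean2_weighted (w₁ := ((k - j : ℕ) : ℝ) / k) (w₂ := j / k)
      (by positivity) (by positivity) (pow_nonneg h1 k) (pow_nonneg h2 k)
      (by rw [hjr]; field_simp; ring)
    rw [hr _ h1, hr _ h2, hjr, div_pow, div_pow, div_pow, div_pow] at h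
    calc _ = (a ^ (k - j) * b ^ j) * (u x ^ (k - j) / a ^ (k - j) * (v x ^ j / b ^ j)) := by
          field_simp
      _ ≤ _ := mul_le_mul_of_nonneg_left h (by positivity)
  refine (Finset.sum_le_sum fun x _ => key x).trans ?_
  rw [← Finset.mul_sum, mul_comm C]
  refine mul_le_mul_of_nonneg_left ?_ (by positivity)
  rw [Finset.sum_add_distrib, ← Finset.mul_sum, ← Finset.mul_sum, ← Finset.sum_div,
    ← Finset.sum_div]
  have h1 : (∑ x ∈ s, u x ^ k) / a ^ k ≤ C := (div_le_iff₀ (by positivity)).2 hua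
  have h2 : (∑ x ∈ s, v x ^ k) / b ^ k ≤ C := (div_le_iff₀ (by positivity)).2 hvb
  calc _ ≤ (k - j) / k * C + j / k * C := by
        have : (0 : ℝ) ≤ (k - j) / k := div_nonneg (by linarith) hk0.le
        gcongr
    _ = C := by field_simp; ring

/-! ### Characters of `ZMod m` and Parseval. -/

theorem AddChar.map_finset_sum {G M ι : Type*} [AddCommMonoid G] [CommMonoid M]
    (ψ : AddChar G M) (s : Finset ι) (g : ι → G) : ψ (∑ i ∈ s, g i) = ∏ i ∈ s, ψ (g i) := by
  classical
  induction s using Finset.induction_on with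
  | empty => simp
  | insert i s hi ih => rw [Finset.sum_insert hi, Finset.prod_insert hi, map_add_eq_mul, ih]

/-- Parseval's identity on `ZMod m` for an injective family of frequencies. -/
theorem ZMod.sum_norm_sq_sum_stdAddChar {m : ℕ} [NeZero m] {ι : Type*} (s : Finset ι)
    (g : ι → ZMod m) (hg : Set.InjOn g s) (c : ι → ℂ) :
    ∑ x : ZMod m, ‖∑ j ∈ s, c j * ZMod.stdAddChar (x * g j)‖ ^ 2 = m * ∑ j ∈ s, ‖c j‖ ^ 2 := by
  classical
  apply Complex.ofReal_injective
  push_cast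
  have h : ∀ x : ZMod m, ((‖∑ j ∈ s, c j * ZMod.stdAddChar (x * g j)‖ : ℂ)) ^ 2 =
      ∑ i ∈ s, ∑ j ∈ s, c i * (starRingEnd ℂ) (c j) *
        ZMod.stdAddChar (x * (g i - g j)) := by
    intro x
    rw [← Complex.mul_conj', map_sum, Finset.sum_mul_sum]
    refine Finset.sum_congr rfl fun i _ => Finset.sum_congr rfl fun j _ => ?_
    rw [map_mul (starRingEnd ℂ), ← AddChar.map_neg_eq_conj, mul_sub, sub_eq_add_neg, AddChar.map_add_eq_mul]
    ring
  simp_rw [h]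
  rw [Finset.sum_comm, Finset.mul_sum]
  refine Finset.sum_congr rfl fun i hi => ?_
  rw [Finset.sum_comm, Finset.sum_eq_single_of_mem i hi]
  · simp [Complex.mul_conj', mul_comm]
  · intro j hj hji
    rw [← Finset.mul_sum, AddChar.sum_mulShift _ (ZMod.isPrimitive_stdAddChar m), if_neg, Nat.cast_zero,
      mul_zero]
    exact sub_ne_zero.2 fun e => hji (hg hj hi e.symm)

/-- Expand the k-th power binomially and apply Parseval; k < m keeps the frequencies 0, …, k
distinct modulo m. -/
theorem ZMod.sum_norm_add_stdAddChar_mul_pow {m k : ℕ} [NeZero m] (hkm : k < m) (z w : ℂ) :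
    ∑ x : ZMod m, ‖z + ZMod.stdAddChar x * w‖ ^ (2 * k) =
      m * ∑ j ∈ range (k + 1), (k.choose j : ℝ) ^ 2 *
        ((‖z‖ ^ 2) ^ (k - j) * (‖w‖ ^ 2) ^ j) := by
  have hinj : Set.InjOn (fun j : ℕ => (j : ZMod m)) (range (k + 1)) := by
    intro i hi j hj hij
    have hi' := Finset.mem_range.1 hi
    have hj' := Finset.mem_range.1 hj
    have := (ZMod.natCast_eq_natCast_iff' i j m).1 hij
    rwa [Nat.mod_eq_of_lt (by omega), Nat.mod_eq_of_lt (by omega)] at this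
  have h := ZMod.sum_norm_sq_sum_stdAddChar (range (k + 1)) (fun j : ℕ => (j : ZMod m)) hinj
    (fun j => w ^ j * z ^ (k - j) * k.choose j)
  convert h using 2 with x
  · rw [pow_mul', ← norm_pow, add_comm, add_pow]
    congr 2
    refine Finset.sum_congr rfl fun j _ => ?_
    rw [mul_comm x, ← nsmul_eq_mul, AddChar.map_nsmul_eq_pow, mul_pow]
    ring
  · refine Finset.sum_congr rfl fun j _ => ?_
    rw [norm_mul, norm_mul, norm_pow, norm_pow, Complex.norm_natCast]
    ring

/-! ### Fourier analysis on the cube and induction on dimension. -/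

theorem sum_discreteHypercube_succ {M : Type*} [AddCommMonoid M] (d : ℕ)
    (g : (Fin (d + 1) → ℤ) → M) :
    ∑ a ∈ discreteHypercube (d + 1), g a =
      ∑ a ∈ discreteHypercube d, g (Fin.cons 0 a) + ∑ a ∈ discreteHypercube d, g (Fin.cons 1 a) := by
  have h : ∑ a ∈ discreteHypercube (d + 1), g a =
      ∑ p ∈ ({0, 1} : Finset ℤ) ×ˢ discreteHypercube d, g (Fin.cons p.1 p.2) := by
    refine Finset.sum_nbij' (fun a => (a 0, Fin.tail a)) (fun p => Fin.cons p.1 p.2) ?_ ?_ ?_ ?_ ?_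
    · intro a ha
      have ha := Fintype.mem_piFinset.1 ha
      exact Finset.mem_product.2 ⟨ha 0, Fintype.mem_piFinset.2 fun i => ha i.succ⟩
    · intro p hp
      obtain ⟨h1, h2⟩ := Finset.mem_product.1 hp
      refine Fintype.mem_piFinset.2 fun i => ?_
      refine Fin.cases ?_ (fun i => ?_) i
      · simpa using h1
      · simpa using Fintype.mem_piFinset.1 h2 i
    · intro a _; exact Fin.cons_self_tail a
    · intro p _; simp
    · intro a _; simp
  rw [h, Finset.sum_product, Finset.sum_pair (by norm_num)]

/-- The Fourier transform, over `(ZMod m)^d`, of a function on the discrete cube. -/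
noncomputable def cubeFourier (m : ℕ) [NeZero m] {d : ℕ} (f : (Fin d → ℤ) → ℂ)
    (x : Fin d → ZMod m) : ℂ :=
  ∑ a ∈ discreteHypercube d, f a * ZMod.stdAddChar (∑ l, x l * (a l : ZMod m))

theorem cubeFourier_cons (m : ℕ) [NeZero m] {d : ℕ} (f : (Fin (d + 1) → ℤ) → ℂ) (y : ZMod m)
    (x : Fin d → ZMod m) :
    cubeFourier m f (Fin.cons y x : Fin (d + 1) → ZMod m) =
      cubeFourier m (fun a => f (Fin.cons 0 a)) x +
        ZMod.stdAddChar y * cubeFourier m (fun a => f (Fin.cons 1 a)) x := by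
  unfold cubeFourier
  rw [sum_discreteHypercube_succ, Finset.mul_sum]
  congr 1
  · refine Finset.sum_congr rfl fun a _ => ?_
    simp [Fin.sum_univ_succ]
  · refine Finset.sum_congr rfl fun a _ => ?_
    simp only [Fin.sum_univ_succ, Fin.cons_zero, Fin.cons_succ, AddChar.map_add_eq_mul,
      Int.cast_one, mul_one]
    ring

/-- The sharp Hausdorff–Young type inequality on the discrete cube. -/
theorem sum_norm_cubeFourier_pow_le {m k : ℕ} [NeZero m] (hk : 0 < k) (hkm : k < m) (d : ℕ)
    (f : (Fin d → ℤ) → ℂ) :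
    ∑ x, ‖cubeFourier m f x‖ ^ (2 * k) ≤
      m ^ d * (∑ a ∈ discreteHypercube d, ‖f a‖ ^ (2 * k / energyExponent k)) ^
        energyExponent k := by
  have hp0 := energyExponent_pos hk
  have hk0 : (0 : ℝ) < k := by exact_mod_cast hk
  induction d with
  | zero =>
    have h : discreteHypercube 0 = {default} := by
      ext a; simp [discreteHypercube, eq_iff_true_of_subsingleton]
    simp only [cubeFourier, h, Finset.sum_singleton, Finset.univ_unique, Finset.univ_eq_empty,
      Finset.sum_empty, AddChar.map_zero_eq_one, mul_one, pow_zero, one_mul]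
    rw [← Real.rpow_mul (norm_nonneg _), div_mul_cancel₀ _ hp0.ne', ← Real.rpow_natCast]
    push_cast
    exact le_rfl
  | succ d ih =>
    set p := energyExponent k with hp
    have h0 := ih fun a => f (Fin.cons 0 a)
    have h1 := ih fun a => f (Fin.cons 1 a)
    rw [sum_discreteHypercube_succ]
    set S := ∑ a ∈ discreteHypercube d, ‖f (Fin.cons 0 a)‖ ^ (2 * k / p) with hS
    set T := ∑ a ∈ discreteHypercube d, ‖f (Fin.cons 1 a)‖ ^ (2 * k / p) with hT
    have hS0 : 0 ≤ S := Finset.sum_nonneg fun a _ => Real.rpow_nonneg (norm_nonneg _) _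
    have hT0 : 0 ≤ T := Finset.sum_nonneg fun a _ => Real.rpow_nonneg (norm_nonneg _) _
    set F := cubeFourier m fun a => f (Fin.cons 0 a)
    set G := cubeFourier m fun a => f (Fin.cons 1 a)
    -- Puts the induction hypotheses in the form C·a^k required by Hölder, with C = m^d, a = S^(p/k)
    -- and b = T^(p/k).
    have hr : ∀ y : ℝ, 0 ≤ y → y ^ p = (y ^ (p / k)) ^ k := fun y hy => by
      rw [← Real.rpow_natCast, ← Real.rpow_mul hy, div_mul_cancel₀ _ hk0.ne']
    rw [hr S hS0] at h0
    rw [hr T hT0] at h1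
    simp only [pow_mul] at h0 h1
    have hsplit : ∑ x, ‖cubeFourier m f x‖ ^ (2 * k) =
        ∑ x : Fin d → ZMod m, ∑ y : ZMod m, ‖F x + ZMod.stdAddChar y * G x‖ ^ (2 * k) := by
      rw [← (Fin.consEquiv fun _ => ZMod m).sum_comp, Fintype.sum_prod_type, Finset.sum_comm]
      refine Finset.sum_congr rfl fun x _ => Finset.sum_congr rfl fun y _ => ?_
      exact congrArg (fun z => ‖z‖ ^ (2 * k)) (cubeFourier_cons m f y x)
    rw [hsplit]
    simp_rw [ZMod.sum_norm_add_stdAddChar_mul_pow hkm]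
    rw [← Finset.mul_sum, pow_succ', mul_assoc, Finset.sum_comm]
    refine mul_le_mul_of_nonneg_left ?_ (Nat.cast_nonneg m)
    refine le_trans ?_ (mul_le_mul_of_nonneg_left (sum_sq_choose_le hk hS0 hT0) (by positivity))
    rw [Finset.mul_sum]
    refine Finset.sum_le_sum fun j hj => ?_
    rw [← Finset.mul_sum, mul_left_comm]
    refine mul_le_mul_of_nonneg_left ?_ (sq_nonneg _)
    exact sum_pow_mul_pow_le Finset.univ hk (Nat.lt_succ_iff.1 (Finset.mem_range.1 hj))
      (fun x => sq_nonneg _) (fun x => sq_nonneg _) (by positivity) (Real.rpow_nonneg hS0 _)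
      (Real.rpow_nonneg hT0 _) h0 h1

/-! ### Energy as a Fourier moment, and the upper bound. -/

theorem ZMod.sum_stdAddChar_dotProduct (m : ℕ) [NeZero m] {d : ℕ} (y : Fin d → ZMod m) :
    ∑ x : Fin d → ZMod m, (ZMod.stdAddChar (∑ l, x l * y l) : ℂ) =
      if y = 0 then (m : ℂ) ^ d else 0 := by
  simp_rw [AddChar.map_finset_sum]
  have h := Finset.prod_univ_sum (fun _ : Fin d => (Finset.univ : Finset (ZMod m)))
    fun l t => (ZMod.stdAddChar (t * y l) : ℂ)
  rw [Fintype.piFinset_univ] at h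
  rw [← h]
  simp_rw [AddChar.sum_mulShift _ (ZMod.isPrimitive_stdAddChar m)]
  split_ifs with hy
  · simp [hy]
  · obtain ⟨l, hl⟩ := Function.ne_iff.1 hy
    exact Finset.prod_eq_zero (Finset.mem_univ l) (by rw [if_neg (by simpa using hl), Nat.cast_zero])

theorem natCast_mul_additiveEnergyK {m k d : ℕ} [NeZero m] (hkm : k < m)
    {A : Finset (Fin d → ℤ)} (hA : A ⊆ discreteHypercube d) :
    (m : ℝ) ^ d * additiveEnergyK k A =
      ∑ x : Fin d → ZMod m,
        ‖∑ a ∈ A, (ZMod.stdAddChar (∑ l, x l * (a l : ZMod m)) : ℂ)‖ ^ (2 * k) := by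
  apply Complex.ofReal_injective
  push_cast
  have hcoord : ∀ a ∈ A, ∀ l, 0 ≤ a l ∧ a l ≤ 1 := fun a ha l => by
    have := Fintype.mem_piFinset.1 (hA ha) l
    simp only [Finset.mem_insert, Finset.mem_singleton] at this
    omega
  have h : ∀ x : Fin d → ZMod m,
      ((‖∑ a ∈ A, (ZMod.stdAddChar (∑ l, x l * (a l : ZMod m)) : ℂ)‖ : ℂ)) ^ (2 * k) =
      ∑ a ∈ Fintype.piFinset fun _ : Fin (k + k) => A, ZMod.stdAddChar (∑ l, x l *
        (((∑ i : Fin k, a (Fin.castAdd k i) l - ∑ i : Fin k, a (Fin.natAdd k i) l : ℤ)) :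
          ZMod m)) := by
    intro x
    -- |F|^(2k) is a product of k copies of F and k conjugates, one for each entry of the 2k-tuple.
    have h1 := Finset.prod_univ_sum (fun _ : Fin (k + k) => A) fun i a =>
      (Fin.addCases (fun _ => ZMod.stdAddChar (∑ l, x l * (a l : ZMod m)))
        (fun _ => (starRingEnd ℂ) (ZMod.stdAddChar (∑ l, x l * (a l : ZMod m)))) i : ℂ)
    rw [Fin.prod_univ_add] at h1
    simp only [Fin.addCases_left, Fin.addCases_right, Finset.prod_const, Finset.card_univ,
      Fintype.card_fin, ← map_sum, ← mul_pow, Complex.mul_conj', ← pow_mul] at h1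
    rw [h1]
    refine Finset.sum_congr rfl fun a _ => ?_
    rw [Fin.prod_univ_add]
    simp only [Fin.addCases_left, Fin.addCases_right, ← AddChar.map_neg_eq_conj]
    rw [← AddChar.map_finset_sum, ← AddChar.map_finset_sum, ← AddChar.map_add_eq_mul]
    congr 1
    push_cast
    simp only [mul_sub, Finset.sum_sub_distrib, Finset.mul_sum, Finset.sum_neg_distrib]
    rw [Finset.sum_comm, Finset.sum_comm (γ := Fin k) (α := Fin d), sub_eq_add_neg]
  simp_rw [h]
  rw [Finset.sum_comm]
  simp_rw [ZMod.sum_stdAddChar_dotProduct]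
  rw [← Finset.sum_filter, Finset.sum_const, nsmul_eq_mul, mul_comm]
  congr 2
  unfold additiveEnergyK
  congr 1
  refine Finset.filter_congr fun a ha => ?_
  have ha := Fintype.mem_piFinset.1 ha
  rw [funext_iff, funext_iff]
  refine forall_congr' fun l => ?_
  have bound : ∀ e : Fin k → Fin (k + k), 0 ≤ ∑ i, a (e i) l ∧ ∑ i, a (e i) l ≤ k := fun e =>
    ⟨Finset.sum_nonneg fun i _ => (hcoord _ (ha _) l).1, by
      simpa using Finset.sum_le_card_nsmul Finset.univ (fun i => a (e i) l) 1
        fun i _ => (hcoord _ (ha _) l).2⟩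
  have b1 := bound (Fin.castAdd k)
  have b2 := bound (Fin.natAdd k)
  rw [Finset.sum_apply, Finset.sum_apply, Pi.zero_apply, ZMod.intCast_zmod_eq_zero_iff_dvd]
  constructor
  · intro e; rw [e]; simp
  -- Both coordinate sums lie in [0, k], so their difference is less than m in absolute value: a
  -- congruence modulo m is an equality.
  · intro e
    have := Int.eq_zero_of_abs_lt_dvd e (by rw [abs_lt]; constructor <;> omega)
    omega

theorem additiveEnergyK_le {d k : ℕ} (hk : 0 < k) {A : Finset (Fin d → ℤ)}
    (hA : A ⊆ discreteHypercube d) :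
    (additiveEnergyK k A : ℝ) ≤ (A.card : ℝ) ^ energyExponent k := by
  have hp0 := energyExponent_pos hk
  have hk0 : (0 : ℝ) < k := by exact_mod_cast hk
  have h := sum_norm_cubeFourier_pow_le (m := k + 1) hk k.lt_succ_self d
    fun a => if a ∈ A then 1 else 0
  have h1 : ∀ x, cubeFourier (k + 1) (fun a => if a ∈ A then 1 else 0) x =
      ∑ a ∈ A, (ZMod.stdAddChar (∑ l : Fin d, x l * (a l : ZMod (k + 1))) : ℂ) := by
    intro x
    simp only [cubeFourier, ite_mul, one_mul, zero_mul]
    rw [← Finset.sum_filter, Finset.filter_mem_eq_inter, Finset.inter_eq_right.2 hA]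
  have h2 : ∑ a ∈ discreteHypercube d,
      ‖(if a ∈ A then 1 else 0 : ℂ)‖ ^ (2 * k / energyExponent k) = A.card := by
    have : ∀ a, ‖(if a ∈ A then 1 else 0 : ℂ)‖ ^ (2 * k / energyExponent k) =
        if a ∈ A then 1 else 0 := fun a => by
      split_ifs
      · simp
      · rw [norm_zero, Real.zero_rpow (by positivity)]
    simp_rw [this]
    rw [← Finset.sum_filter, Finset.filter_mem_eq_inter, Finset.inter_eq_right.2 hA]
    simp
  simp_rw [h1] at h
  rw [h2, ← natCast_mul_additiveEnergyK k.lt_succ_self hA] at h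
  exact le_of_mul_le_mul_left h (by positivity)

/-! ### Optimality of the exponent. -/

/-- Every `k`-subset of `2k` positions gives a solution with entries in a pair `{0, v}`. -/
theorem choose_le_additiveEnergyK_pair {d : ℕ} (k : ℕ) {v : Fin d → ℤ} (hv : v ≠ 0) :
    (2 * k).choose k ≤ additiveEnergyK k {0, v} := by
  classical
  -- The set U is complemented on the right half: since |U| = k, it has as many elements on the left
  -- as it misses on the right, so the two sums agree.
  let φ : Finset (Fin (k + k)) → Fin (k + k) → Fin d → ℤ := fun U =>
    Fin.addCases (fun i => if Fin.castAdd k i ∈ U then v else 0)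
      (fun i => if Fin.natAdd k i ∈ U then 0 else v)
  have hφl : ∀ U i, φ U (Fin.castAdd k i) = if Fin.castAdd k i ∈ U then v else 0 := fun U i =>
    Fin.addCases_left i
  have hφr : ∀ U i, φ U (Fin.natAdd k i) = if Fin.natAdd k i ∈ U then 0 else v := fun U i =>
    Fin.addCases_right i
  have hcard : (powersetCard k (univ : Finset (Fin (k + k)))).card = (2 * k).choose k := by
    simp [two_mul]
  rw [← hcard]
  refine Finset.card_le_card_of_injOn φ ?_ ?_
  · intro U hU
    have hU := (Finset.mem_powersetCard.1 hU).2
    refine Finset.mem_coe.2 (Finset.mem_filter.2 ⟨Fintype.mem_piFinset.2 fun i => ?_, ?_⟩)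
    · refine Fin.addCases (fun i => ?_) (fun i => ?_) i
      · rw [hφl]; split_ifs <;> simp
      · rw [hφr]; split_ifs <;> simp
    · simp only [hφl, hφr]
      have h1 : ∑ i : Fin (k + k), (if i ∈ U then v else 0) = k • v := by
        rw [← Finset.sum_filter, Finset.sum_const, Finset.filter_univ_mem, hU]
      rw [Fin.sum_univ_add] at h1
      have h2 : ∑ i : Fin k, (if Fin.natAdd k i ∈ U then v else 0) +
          ∑ i : Fin k, (if Fin.natAdd k i ∈ U then 0 else v) = k • v := by
        rw [← Finset.sum_add_distrib]
        refine (Finset.sum_congr rfl fun i _ => ?_).trans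
          (by simp : ∑ _i : Fin k, v = k • v)
        split_ifs <;> simp
      rw [← h1, add_comm] at h2
      exact (add_right_cancel h2).symm
  · intro U _ V _ h
    ext i
    have hi := congrFun h i
    revert hi
    refine Fin.addCases (fun i => ?_) (fun i => ?_) i
    · rw [hφl, hφl]
      split_ifs with h1 h2 h2 <;> intro e <;> first
        | exact iff_of_true h1 h2
        | exact iff_of_false h1 h2
        | exact absurd e hv
        | exact absurd e.symm hv
    · rw [hφr, hφr]
      split_ifs with h1 h2 h2 <;> intro e <;> first
        | exact iff_of_true h1 h2
        | exact iff_of_false h1 h2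
        | exact absurd e hv
        | exact absurd e.symm hv

theorem corollary2 (d k : ℕ) (hd : 0 < d) (hk : 0 < k) :
    (∀ A : Finset (Fin d → ℤ), A ⊆ discreteHypercube d →
      (additiveEnergyK k A : ℝ) ≤ (A.card : ℝ) ^ energyExponent k) ∧
    (∀ q : ℝ,
      (∀ A : Finset (Fin d → ℤ), A ⊆ discreteHypercube d →
        (additiveEnergyK k A : ℝ) ≤ (A.card : ℝ) ^ q) →
      energyExponent k ≤ q) := by
  refine ⟨fun A hA => additiveEnergyK_le hk hA, fun q hq => ?_⟩
  -- Testing on the pair formed by 0 and the all-ones vector gives C(2k,k) ≤ 2^q.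
  have hv : (1 : Fin d → ℤ) ≠ 0 := fun h => one_ne_zero (congrFun h ⟨0, hd⟩)
  have h1 := hq {0, 1} (by
    intro a ha
    simp only [Finset.mem_insert, Finset.mem_singleton] at ha
    refine Fintype.mem_piFinset.2 fun i => ?_
    rcases ha with rfl | rfl <;> simp)
  rw [Finset.card_pair hv.symm] at h1
  have h2 : ((2 * k).choose k : ℝ) ≤ additiveEnergyK k {0, (1 : Fin d → ℤ)} := by
    exact_mod_cast choose_le_additiveEnergyK_pair k hv
  unfold energyExponent
  rw [Real.logb_le_iff_le_rpow (by norm_num) (by exact_mod_cast Nat.choose_pos (by omega))]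
  exact_mod_cast h2.trans h1
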